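/- **$\mathbb C^3/\mathbb Z_4$ is not a schematic complete intersection.** Let $\mathbb Z_4\subset \mathrm{SL}_3(\mathbb C)$ be the group generated by $\mathrm{diag}(i,i,-1)$, and let $\mathbb C^3/\mathbb Z_4$ be the affine variety with coordinate ring $\mathbb C[z_1,z_2,z_3]^{\mathbb Z_4}$. Let $\sigma\subset\mathbb R^3$ be the cone generated by $(1,0,0)$, $(-1,2,0)$, $(0,-1,2)$, let $\sigma^\vee$ be its dual cone (with respect to the dot product), and let $S_\sigma=\sigma^\vee\cap\mathbb Z^3$. A *Hilbert basis* of $S_\sigma$ is a minimal set of generators of $S_\sigma$ which contains the rational generators of the rays of $\sigma^\vee$. For ideals $I,J$ of a ring $R$ put $I:J^\infty=\{a\in R \mid aJ^N\subset I \text{ for } N\gg0\}$. An affine variety $X\subset\mathbb C^D$ of codimension $d$ with ideal $I(X)$ is a *schematic complete intersection* if the minimal number of generators of $I(X)$ is $d$. Then: 1. $\sigma$ is strongly convex; the rational generators of the rays of $\sigma^\vee$ are $(4,2,1)$, $(0,2,1)$, $(0,0,1)$; the group $\mathbb Z_4$ has order $4$; and $\mathbb C[z_1,z_2,z_3]^{\mathbb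 Z_4}\cong\mathbb C[S_\sigma]$ as $\mathbb C$-algebras, so that $\mathbb C^3/\mathbb Z_4\cong X_\sigma=\operatorname{Specm}\mathbb C[S_\sigma]$. 2. The nine distinct points $$m_1,\dots,m_9=(4,2,1),(0,2,1),(0,0,1),(1,1,1),(0,1,1),(1,2,1),(2,1,1),(2,2,1),(3,2,1)$$ form a Hilbert basis of $S_\sigma$. The characters $\chi^{m_1},\dots,\chi^{m_9}$ embed $X_\sigma$ as a Zariski closed subset $X\subset\mathbb C^9$ whose coordinate ring $\mathbb C[x_1,\dots,x_9]/I(X)$ is $\mathbb C[S_\sigma]$, with $x_i$ corresponding to $\chi^{m_i}$. 3. $I(X)=I_{\sigma,0}:K^\infty$, where $K=(x_1x_2\cdots x_9)$ and $I_{\sigma,0}$ is generated by the six binomials $$x_1x_8-x_9^2,\quad x_2x_9^2-x_8^3,\quad x_3x_9^2-x_7^2x_8,\quad x_4x_9-x_7x_8,\quad x_5x_9^2-x_7x_8^2,\quad x_6x_9-x_8^2 .$$ 4. $I(X)$ is generated by the 20 quadrics $$\begin{array}{lllll} x_8^2-x_6x_9, & x_7x_8-x_4x_9, & x_6x_8-x_2x_9,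 & x_4x_8-x_5x_9, & x_1x_8-x_9^2,\\ x_6x_7-x_5x_9, & x_5x_7-x_3x_8, & x_4x_7-x_3x_9, & x_2x_7-x_5x_8, & x_6^2-x_2x_8,\\ x_4x_6-x_5x_8, & x_1x_6-x_8x_9, & x_4x_5-x_3x_6, & x_1x_5-x_4x_9, & x_4^2-x_3x_8,\\ x_2x_4-x_5x_6, & x_1x_4-x_7x_9, & x_2x_3-x_5^2, & x_1x_3-x_7^2, & x_1x_2-x_6x_9 . \end{array}$$ None of these quadrics can be omitted, and the minimal number of generators of $I(X)$ is $20$. 5. Consequently $X\cong\mathbb C^3/\mathbb Z_4$ is not a schematic complete intersection. -/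

import Mathlib

namespace ToricC3Z4

open MvPolynomial

noncomputable section

/-! Affine toric varieties: `N = M = ℤⁿ`, paired by the dot product. -/

/-- The inclusion of the lattice `ℤⁿ` in `ℝⁿ`. -/
def toReal {n : ℕ} (m : Fin n → ℤ) : Fin n → ℝ := fun i => (m i : ℝ)

/-- The dual cone `σ^∨ = {u | ⟨v, u⟩ ≥ 0 for all v ∈ σ}`. -/
def dualCone {n : ℕ} (σ : PointedCone ℝ (Fin n → ℝ)) : PointedCone ℝ (Fin n → ℝ) :=
  PointedCone.dual (dotProductBilin ℝ ℝ) (σ : Set (Fin n → ℝ))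

/-- The semigroup `S_σ = σ^∨ ∩ M`. -/
def semigroup {n : ℕ} (σ : PointedCone ℝ (Fin n → ℝ)) : AddSubmonoid (Fin n → ℤ) where
  carrier := {m | toReal m ∈ dualCone σ}
  zero_mem' := by
    have h : toReal (0 : Fin n → ℤ) = 0 := by ext i; simp [toReal]
    simp only [Set.mem_ofPred_eq, h, zero_mem]
  add_mem' := by
    intro a b ha hb
    have h : toReal (a + b) = toReal a + toReal b := by ext i; simp [toReal]
    simp only [Set.mem_ofPred_eq, h] at ha hb ⊢
    exact add_mem ha hb

/-- `m` is the rational (ray) generator of a ray of the cone `C`: a primitive lattice vector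
spanning a one-dimensional face of `C`. -/
def IsRayGenerator {n : ℕ} (C : PointedCone ℝ (Fin n → ℝ)) (m : Fin n → ℤ) : Prop :=
  m ≠ 0 ∧ (∀ (k : ℤ) (m' : Fin n → ℤ), m = k • m' → IsUnit k) ∧
    (PointedCone.hull ℝ {toReal m}).IsFaceOf C

/-- A Hilbert basis of `S_σ`: a minimal set of generators of `S_σ` which contains the rational
generators of the rays of `σ^∨`. -/
def IsHilbertBasis {n : ℕ} (σ : PointedCone ℝ (Fin n → ℝ)) (H : Set (Fin n → ℤ)) : Prop :=
  AddSubmonoid.closure H = semigroup σ ∧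
    (∀ H' : Set (Fin n → ℤ), H' ⊂ H → AddSubmonoid.closure H' ≠ semigroup σ) ∧
    {m | IsRayGenerator (dualCone σ) m} ⊆ H

/-- The semigroup algebra `ℂ[S_σ]`. -/
abbrev SemigroupAlgebra {n : ℕ} (σ : PointedCone ℝ (Fin n → ℝ)) : Type :=
  AddMonoidAlgebra ℂ (semigroup σ)

/-- The character `χ^m ∈ ℂ[S_σ]`. -/
def character {n : ℕ} {σ : PointedCone ℝ (Fin n → ℝ)} (m : semigroup σ) : SemigroupAlgebra σ :=
  AddMonoidAlgebra.single m 1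

/-- The affine toric variety `X_σ = Specm ℂ[S_σ]` as a subset of `ℂ^D`, embedded by the elements
`m 1, …, m D` of `S_σ`: a maximal ideal `𝔪` has as coordinates the values `p i ∈ ℂ` of the
functions `χ^(m i)` at `𝔪`. -/
def toricVariety {n D : ℕ} (σ : PointedCone ℝ (Fin n → ℝ)) (m : Fin D → semigroup σ) :
    Set (Fin D → ℂ) :=
  {p | ∃ 𝔪 : MaximalSpectrum (SemigroupAlgebra σ),
    ∀ i, character (m i) - algebraMap ℂ (SemigroupAlgebra σ) (p i) ∈ 𝔪.asIdeal}

/-! Affine varieties and complete intersections. -/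

/-- The coordinate ring `A(X) = ℂ[x₁, …, x_D] / I(X)` of `X ⊆ ℂ^D`. -/
abbrev CoordinateRing {D : ℕ} (X : Set (Fin D → ℂ)) : Type :=
  MvPolynomial (Fin D) ℂ ⧸ vanishingIdeal ℂ X

/-- `X ⊆ ℂ^D` is a schematic complete intersection: the minimal number of generators of its ideal
is the codimension `d` of `X` in `ℂ^D` (the dimension of `X` being the Krull dimension of
`A(X)`). -/
def IsSchematicCompleteIntersection {D : ℕ} (X : Set (Fin D → ℂ)) : Prop :=
  ∃ d : ℕ, ringKrullDim (CoordinateRing X) + (d : WithBot ℕ∞) = (D : WithBot ℕ∞) ∧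
    Submodule.spanFinrank (vanishingIdeal ℂ X) = d

/-- The saturation `I : J^∞ = {a | a J^N ⊆ I for N ≫ 0}`. -/
def saturation {R : Type*} [CommRing R] (I J : Ideal R) : Ideal R where
  carrier := {a | ∃ N₀ : ℕ, ∀ N, N₀ ≤ N → ∀ b ∈ J ^ N, a * b ∈ I}
  zero_mem' := ⟨0, fun N _ b _ => by simp⟩
  add_mem' := by
    rintro a a' ⟨N, hN⟩ ⟨N', hN'⟩
    refine ⟨max N N', fun n hn b hb => ?_⟩
    rw [add_mul]
    exact I.add_mem (hN n (le_trans (le_max_left _ _) hn) b hb)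
      (hN' n (le_trans (le_max_right _ _) hn) b hb)
  smul_mem' := by
    rintro c a ⟨N, hN⟩
    refine ⟨N, fun n hn b hb => ?_⟩
    rw [smul_eq_mul, mul_assoc]
    exact I.mul_mem_left c (hN n hn b hb)

/-! Linear quotients `ℂⁿ / Γ`. -/

/-- The substitution `f(z) ↦ f(g z)` on `ℂ[z₁, …, z_n]`. -/
def substitution {n : ℕ} (g : Matrix.SpecialLinearGroup (Fin n) ℂ) :
    MvPolynomial (Fin n) ℂ →ₐ[ℂ] MvPolynomial (Fin n) ℂ :=
  aeval fun i => ∑ j, C (g.1 i j) * X j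

/-- The invariant ring `ℂ[z₁, …, z_n]^Γ`, which is the coordinate ring of the affine variety
`ℂⁿ / Γ`. -/
def invariantRing {n : ℕ} (Γ : Subgroup (Matrix.SpecialLinearGroup (Fin n) ℂ)) :
    Subalgebra ℂ (MvPolynomial (Fin n) ℂ) :=
  ⨅ g ∈ Γ, AlgHom.equalizer (substitution g) (AlgHom.id ℂ _)

/-- The matrix `diag(i, i, -1)`. -/
def generator : Matrix.SpecialLinearGroup (Fin 3) ℂ :=
  ⟨Matrix.diagonal ![Complex.I, Complex.I, -1], by
    simp [Matrix.det_diagonal, Fin.prod_univ_three]⟩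

/-- The group `ℤ₄ ⊆ SL₃(ℂ)` generated by `diag(i, i, -1)`. -/
def Z4 : Subgroup (Matrix.SpecialLinearGroup (Fin 3) ℂ) := Subgroup.zpowers generator

/-! The data for `ℂ³ / ℤ₄`. -/

/-- The cone `σ` with generators `(1,0,0)`, `(-1,2,0)`, `(0,-1,2)`. -/
def cone : PointedCone ℝ (Fin 3 → ℝ) :=
  PointedCone.hull ℝ {![1, 0, 0], ![-1, 2, 0], ![0, -1, 2]}

/-- The lattice points to which the variables `x₁, …, x₉` are assigned. -/
def latticePoint : Fin 9 → Fin 3 → ℤ :=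
  ![![4, 2, 1], ![0, 2, 1], ![0, 0, 1], ![1, 1, 1], ![0, 1, 1], ![1, 2, 1], ![2, 1, 1],
    ![2, 2, 1], ![3, 2, 1]]

lemma mem_semigroup_cone {m : Fin 3 → ℤ} :
    m ∈ semigroup cone ↔ 0 ≤ m 0 ∧ m 0 ≤ 2 * m 1 ∧ m 1 ≤ 2 * m 2 := by
  change toReal m ∈ PointedCone.dual (dotProductBilin ℝ ℝ)
    ((PointedCone.hull ℝ {![1, 0, 0], ![-1, 2, 0], ![0, -1, 2]} :
      PointedCone ℝ (Fin 3 → ℝ)) : Set (Fin 3 → ℝ)) ↔ _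
  rw [PointedCone.dual_hull]
  simp only [PointedCone.mem_dual, Set.mem_insert_iff, Set.mem_singleton_iff, forall_eq_or_imp,
    forall_eq, dotProductBilin_apply_apply, dotProduct, Fin.sum_univ_three, toReal]
  simp only [Matrix.cons_val_zero, Matrix.cons_val_one, Matrix.cons_val]
  refine and_congr ?_ (and_congr ?_ ?_)
  · simp
  · rw [← @Int.cast_le ℝ]; push_cast; constructor <;> intro h <;> linarith
  · rw [← @Int.cast_le ℝ]; push_cast; constructor <;> intro h <;> linarith

lemma latticePoint_mem (i : Fin 9) : latticePoint i ∈ semigroup cone := by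
  rw [mem_semigroup_cone]
  revert i
  decide

/-- The lattice points as elements of `S_σ`. -/
def hilbertBasis (i : Fin 9) : semigroup cone := ⟨latticePoint i, latticePoint_mem i⟩

/-- `ℂ³ / ℤ₄` as a toric variety in `ℂ⁹`. -/
def variety : Set (Fin 9 → ℂ) := toricVariety cone hilbertBasis

/-- The polynomial ring `ℂ[x₁, …, x₉]`. -/
abbrev Poly : Type := MvPolynomial (Fin 9) ℂ

abbrev x₁ : Poly := X 0
abbrev x₂ : Poly := X 1
abbrev x₃ : Poly := X 2
abbrev x₄ : Poly := X 3
abbrev x₅ : Poly := X 4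
abbrev x₆ : Poly := X 5
abbrev x₇ : Poly := X 6
abbrev x₈ : Poly := X 7
abbrev x₉ : Poly := X 8

/-- The ideal `I_{σ,0}` generated by six binomials. -/
def I₀ : Ideal Poly :=
  Ideal.span {x₁ * x₈ - x₉ ^ 2, x₂ * x₉ ^ 2 - x₈ ^ 3, x₃ * x₉ ^ 2 - x₇ ^ 2 * x₈,
    x₄ * x₉ - x₇ * x₈, x₅ * x₉ ^ 2 - x₇ * x₈ ^ 2, x₆ * x₉ - x₈ ^ 2}

/-- The principal ideal `K = (x₁ ⋯ x₉)`. -/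
def K : Ideal Poly := Ideal.span {x₁ * x₂ * x₃ * x₄ * x₅ * x₆ * x₇ * x₈ * x₉}

/-- The 20 quadrics. -/
def quadric : Fin 20 → Poly :=
  ![x₈ ^ 2 - x₆ * x₉, x₇ * x₈ - x₄ * x₉, x₆ * x₈ - x₂ * x₉, x₄ * x₈ - x₅ * x₉, x₁ * x₈ - x₉ ^ 2,
    x₆ * x₇ - x₅ * x₉, x₅ * x₇ - x₃ * x₈, x₄ * x₇ - x₃ * x₉, x₂ * x₇ - x₅ * x₈, x₆ ^ 2 - x₂ * x₈,
    x₄ * x₆ - x₅ * x₈, x₁ * x₆ - x₈ * x₉, x₄ * x₅ - x₃ * x₆, x₁ * x₅ - x₄ * x₉, x₄ ^ 2 - x₃ * x₈,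
    x₂ * x₄ - x₅ * x₆, x₁ * x₄ - x₇ * x₉, x₂ * x₃ - x₅ ^ 2, x₁ * x₃ - x₇ ^ 2, x₁ * x₂ - x₆ * x₉]

end

end ToricC3Z4

namespace ToricC3Z4

open MvPolynomial

noncomputable section

/-- The index pairs of the leading monomials of the quadrics. -/
def quadricLead : Fin 20 → Fin 9 × Fin 9 :=
  ![(7, 7), (6, 7), (5, 7), (3, 7), (0, 7), (5, 6), (4, 6), (3, 6), (1, 6), (5, 5), (3, 5), (0, 5), (3, 4), (0, 4), (3, 3), (1, 3), (0, 3), (1, 2), (0, 2), (0, 1)]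

/-- The index pairs of the trailing monomials of the quadrics. -/
def quadricTail : Fin 20 → Fin 9 × Fin 9 :=
  ![(5, 8), (3, 8), (1, 8), (4, 8), (8, 8), (4, 8), (2, 7), (2, 8), (4, 7), (1, 7), (4, 7), (7, 8), (2, 5), (3, 8), (2, 7), (4, 5), (6, 8), (4, 4), (6, 6), (5, 8)]

lemma quadric_eq (j : Fin 20) :
    quadric j = X (quadricLead j).1 * X (quadricLead j).2 -
      X (quadricTail j).1 * X (quadricTail j).2 := by
  fin_cases j <;> simp [quadric, quadricLead, quadricTail] <;> ring

/-- The weight in `S_σ` of an exponent vector. -/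
def weight : (Fin 9 →₀ ℕ) →+ semigroup cone :=
  Finsupp.liftAddHom fun i => multiplesHom _ (hilbertBasis i)

lemma weight_single (i : Fin 9) (k : ℕ) : weight (Finsupp.single i k) = k • hilbertBasis i := by
  simp [weight]

/-- The homomorphism `ℂ[x₁, …, x₉] → ℂ[S_σ]`, `x_i ↦ χ^(m_i)`. -/
def toSemigroupAlgebra : Poly →ₐ[ℂ] SemigroupAlgebra cone :=
  aeval fun i => character (hilbertBasis i)

lemma toSemigroupAlgebra_X (i : Fin 9) :
    toSemigroupAlgebra (X i) = character (hilbertBasis i) := by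
  simp [toSemigroupAlgebra]

lemma toSemigroupAlgebra_monomial (d : Fin 9 →₀ ℕ) (c : ℂ) :
    toSemigroupAlgebra (monomial d c) = AddMonoidAlgebra.single (weight d) c := by
  have h1 : toSemigroupAlgebra (monomial d 1) = AddMonoidAlgebra.single (weight d) 1 := by
    induction d using Finsupp.induction_linear with
    | zero => exact (map_one toSemigroupAlgebra).trans AddMonoidAlgebra.one_def
    | add f g hf hg =>
      rw [← one_mul (1 : ℂ), ← monomial_mul, map_mul, hf, hg, map_add,
        AddMonoidAlgebra.single_mul_single]
    | single i k =>
      rw [← X_pow_eq_monomial, map_pow, toSemigroupAlgebra_X, weight_single, character,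
        AddMonoidAlgebra.single_pow, one_pow]
  rw [← mul_one c, ← smul_eq_mul, ← smul_monomial, map_smul, h1, AddMonoidAlgebra.smul_single]

lemma hilbertBasis_add_eq (j : Fin 20) :
    hilbertBasis (quadricLead j).1 + hilbertBasis (quadricLead j).2 =
      hilbertBasis (quadricTail j).1 + hilbertBasis (quadricTail j).2 := by
  apply Subtype.ext
  change latticePoint _ + latticePoint _ = latticePoint _ + latticePoint _
  revert j
  decide

lemma toSemigroupAlgebra_quadric (j : Fin 20) : toSemigroupAlgebra (quadric j) = 0 := by
  rw [quadric_eq, map_sub, map_mul, map_mul]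
  simp only [toSemigroupAlgebra_X, character, AddMonoidAlgebra.single_mul_single,
    hilbertBasis_add_eq, sub_self]

/-- The ideal generated by the 20 quadrics. -/
abbrev quadricIdeal : Ideal Poly := Ideal.span (Set.range quadric)

lemma quadricIdeal_le_ker : quadricIdeal ≤ RingHom.ker toSemigroupAlgebra := by
  rw [Ideal.span_le]
  rintro _ ⟨j, rfl⟩
  exact toSemigroupAlgebra_quadric j

/-- The basis of the coordinate ring over `ℂ[x₁, x₂, x₃]`, in terms of the coordinates. -/
def moduleBasis {R : Type*} [CommRing R] (y : Fin 9 → R) : Fin 8 → R :=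
  ![1, y 3, y 4, y 5, y 6, y 7, y 8, y 4 * y 8]

lemma exists_mul_moduleBasis {R : Type*} [CommRing R] (y : Fin 9 → R)
    (h : ∀ j, y (quadricLead j).1 * y (quadricLead j).2 =
      y (quadricTail j).1 * y (quadricTail j).2) (i : Fin 9) (e : Fin 8) :
    ∃ (a b c : ℕ) (e' : Fin 8),
      y i * moduleBasis y e = y 0 ^ a * y 1 ^ b * y 2 ^ c * moduleBasis y e' := by
  have h0 : y 7 * y 7 = y 5 * y 8 := h 0
  have h1 : y 6 * y 7 = y 3 * y 8 := h 1
  have h2 : y 5 * y 7 = y 1 * y 8 := h 2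
  have h3 : y 3 * y 7 = y 4 * y 8 := h 3
  have h4 : y 0 * y 7 = y 8 * y 8 := h 4
  have h5 : y 5 * y 6 = y 4 * y 8 := h 5
  have h6 : y 4 * y 6 = y 2 * y 7 := h 6
  have h7 : y 3 * y 6 = y 2 * y 8 := h 7
  have h8 : y 1 * y 6 = y 4 * y 7 := h 8
  have h9 : y 5 * y 5 = y 1 * y 7 := h 9
  have h10 : y 3 * y 5 = y 4 * y 7 := h 10
  have h11 : y 0 * y 5 = y 7 * y 8 := h 11
  have h12 : y 3 * y 4 = y 2 * y 5 := h 12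
  have h13 : y 0 * y 4 = y 3 * y 8 := h 13
  have h14 : y 3 * y 3 = y 2 * y 7 := h 14
  have h15 : y 1 * y 3 = y 4 * y 5 := h 15
  have h16 : y 0 * y 3 = y 6 * y 8 := h 16
  have h17 : y 1 * y 2 = y 4 * y 4 := h 17
  have h18 : y 0 * y 2 = y 6 * y 6 := h 18
  have h19 : y 0 * y 1 = y 5 * y 8 := h 19
  fin_cases i <;> fin_cases e
  · exact ⟨1, 0, 0, 0, by simp⟩
  · exact ⟨1, 0, 0, 1, by simp⟩
  · exact ⟨1, 0, 0, 2, by simp⟩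
  · exact ⟨1, 0, 0, 3, by simp⟩
  · exact ⟨1, 0, 0, 4, by simp⟩
  · exact ⟨1, 0, 0, 5, by simp⟩
  · exact ⟨1, 0, 0, 6, by simp⟩
  · exact ⟨1, 0, 0, 7, by simp⟩
  · exact ⟨0, 1, 0, 0, by simp⟩
  · exact ⟨0, 1, 0, 1, by simp⟩
  · exact ⟨0, 1, 0, 2, by simp⟩
  · exact ⟨0, 1, 0, 3, by simp⟩
  · exact ⟨0, 1, 0, 4, by simp⟩
  · exact ⟨0, 1, 0, 5, by simp⟩
  · exact ⟨0, 1, 0, 6, by simp⟩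
  · exact ⟨0, 1, 0, 7, by simp⟩
  · exact ⟨0, 0, 1, 0, by simp⟩
  · exact ⟨0, 0, 1, 1, by simp⟩
  · exact ⟨0, 0, 1, 2, by simp⟩
  · exact ⟨0, 0, 1, 3, by simp⟩
  · exact ⟨0, 0, 1, 4, by simp⟩
  · exact ⟨0, 0, 1, 5, by simp⟩
  · exact ⟨0, 0, 1, 6, by simp⟩
  · exact ⟨0, 0, 1, 7, by simp⟩
  · exact ⟨0, 0, 0, 1, by simp [moduleBasis, mul_comm]⟩
  · exact ⟨0, 0, 1, 5, by
      simp [moduleBasis]; linear_combination h14⟩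
  · exact ⟨0, 0, 1, 3, by
      simp [moduleBasis]; linear_combination h12⟩
  · exact ⟨0, 1, 0, 4, by
      simp [moduleBasis]; linear_combination h10 - h8⟩
  · exact ⟨0, 0, 1, 6, by
      simp [moduleBasis]; linear_combination h7⟩
  · exact ⟨0, 0, 0, 7, by
      simp [moduleBasis]; linear_combination h3⟩
  · exact ⟨1, 0, 0, 2, by
      simp [moduleBasis]; linear_combination -h13⟩
  · exact ⟨1, 1, 1, 0, by
      simp [moduleBasis]; linear_combination y 8 * h12 - y 2 * h19⟩
  · exact ⟨0, 0, 0, 2, by simp [moduleBasis, mul_comm]⟩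
  · exact ⟨0, 0, 1, 3, by
      simp [moduleBasis]; linear_combination h12⟩
  · exact ⟨0, 1, 1, 0, by
      simp [moduleBasis]; linear_combination -h17⟩
  · exact ⟨0, 1, 0, 1, by
      simp [moduleBasis]; linear_combination -h15⟩
  · exact ⟨0, 0, 1, 5, by
      simp [moduleBasis]; linear_combination h6⟩
  · exact ⟨0, 1, 0, 4, by
      simp [moduleBasis]; linear_combination -h8⟩
  · exact ⟨0, 0, 0, 7, by simp [moduleBasis]⟩
  · exact ⟨0, 1, 1, 6, by
      simp [moduleBasis]; linear_combination -y 8 * h17⟩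
  · exact ⟨0, 0, 0, 3, by simp [moduleBasis, mul_comm]⟩
  · exact ⟨0, 1, 0, 4, by
      simp [moduleBasis]; linear_combination h10 - h8⟩
  · exact ⟨0, 1, 0, 1, by
      simp [moduleBasis]; linear_combination -h15⟩
  · exact ⟨0, 1, 0, 5, by
      simp [moduleBasis]; linear_combination h9⟩
  · exact ⟨0, 0, 0, 7, by
      simp [moduleBasis]; linear_combination h5⟩
  · exact ⟨0, 1, 0, 6, by
      simp [moduleBasis]; linear_combination h2⟩
  · exact ⟨1, 1, 0, 0, by
      simp [moduleBasis]; linear_combination -h19⟩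
  · exact ⟨1, 1, 0, 2, by
      simp [moduleBasis]; linear_combination -y 4 * h19⟩
  · exact ⟨0, 0, 0, 4, by simp [moduleBasis, mul_comm]⟩
  · exact ⟨0, 0, 1, 6, by
      simp [moduleBasis]; linear_combination h7⟩
  · exact ⟨0, 0, 1, 5, by
      simp [moduleBasis]; linear_combination h6⟩
  · exact ⟨0, 0, 0, 7, by
      simp [moduleBasis]; linear_combination h5⟩
  · exact ⟨1, 0, 1, 0, by
      simp [moduleBasis]; linear_combination -h18⟩
  · exact ⟨1, 0, 0, 2, by
      simp [moduleBasis]; linear_combination h1 - h13⟩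
  · exact ⟨1, 0, 0, 1, by
      simp [moduleBasis]; linear_combination -h16⟩
  · exact ⟨1, 0, 1, 3, by
      simp [moduleBasis]; linear_combination -y 6 * h5 - y 5 * h18⟩
  · exact ⟨0, 0, 0, 5, by simp [moduleBasis, mul_comm]⟩
  · exact ⟨0, 0, 0, 7, by
      simp [moduleBasis]; linear_combination h3⟩
  · exact ⟨0, 1, 0, 4, by
      simp [moduleBasis]; linear_combination -h8⟩
  · exact ⟨0, 1, 0, 6, by
      simp [moduleBasis]; linear_combination h2⟩
  · exact ⟨1, 0, 0, 2, by
      simp [moduleBasis]; linear_combination h1 - h13⟩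
  · exact ⟨1, 1, 0, 0, by
      simp [moduleBasis]; linear_combination h0 - h19⟩
  · exact ⟨1, 0, 0, 3, by
      simp [moduleBasis]; linear_combination -h11⟩
  · exact ⟨1, 1, 0, 1, by
      simp [moduleBasis]; linear_combination -y 8 * h8 - y 1 * h16⟩
  · exact ⟨0, 0, 0, 6, by simp [moduleBasis, mul_comm]⟩
  · exact ⟨1, 0, 0, 2, by
      simp [moduleBasis]; linear_combination -h13⟩
  · exact ⟨0, 0, 0, 7, by simp [moduleBasis, mul_comm]⟩
  · exact ⟨1, 1, 0, 0, by
      simp [moduleBasis]; linear_combination -h19⟩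
  · exact ⟨1, 0, 0, 1, by
      simp [moduleBasis]; linear_combination -h16⟩
  · exact ⟨1, 0, 0, 3, by
      simp [moduleBasis]; linear_combination -h11⟩
  · exact ⟨1, 0, 0, 5, by
      simp [moduleBasis]; linear_combination -h4⟩
  · exact ⟨1, 1, 0, 4, by
      simp [moduleBasis]; linear_combination -y 4 * h4 - y 0 * h8⟩

lemma lead_sub_tail_mul_eq_zero {R : Type*} [CommRing R] (y : Fin 9 → R)
    (g0 : y 0 * y 7 = y 8 ^ 2) (g1 : y 1 * y 8 ^ 2 = y 7 ^ 3) (g2 : y 2 * y 8 ^ 2 = y 6 ^ 2 * y 7)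
    (g3 : y 3 * y 8 = y 6 * y 7) (g4 : y 4 * y 8 ^ 2 = y 6 * y 7 ^ 2) (g5 : y 5 * y 8 = y 7 ^ 2)
    (j : Fin 20) :
    (y (quadricLead j).1 * y (quadricLead j).2 - y (quadricTail j).1 * y (quadricTail j).2) *
      (y 7 * y 8 ^ 3) = 0 := by
  fin_cases j <;> simp [quadricLead, quadricTail]
  · linear_combination -y 7 * y 8 ^ 3 * g5
  · linear_combination -y 7 * y 8 ^ 3 * g3
  · linear_combination y 7 ^ 2 * y 8 ^ 2 * g5 - y 7 * y 8 ^ 2 * g1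
  · linear_combination y 7 ^ 2 * y 8 ^ 2 * g3 - y 7 * y 8 ^ 2 * g4
  · linear_combination y 7 * y 8 ^ 3 * g0
  · linear_combination y 6 * y 7 * y 8 ^ 2 * g5 - y 7 * y 8 ^ 2 * g4
  · linear_combination y 6 * y 7 * y 8 * g4 - y 7 ^ 2 * y 8 * g2
  · linear_combination y 6 * y 7 * y 8 ^ 2 * g3 - y 7 * y 8 ^ 2 * g2
  · linear_combination y 6 * y 7 * y 8 * g1 - y 7 ^ 2 * y 8 * g4
  · linear_combination y 5 * y 7 * y 8 ^ 2 * g5 - y 5 * y 8 ^ 2 * g1 + y 1 * y 8 ^ 3 * g5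
  · linear_combination y 5 * y 7 * y 8 ^ 2 * g3 - y 5 * y 8 ^ 2 * g4 + y 4 * y 8 ^ 3 * g5
  · linear_combination y 5 * y 8 ^ 3 * g0 + y 8 ^ 4 * g5
  · linear_combination y 4 * y 7 * y 8 ^ 2 * g3 + y 6 * y 7 ^ 2 * g4 - y 7 ^ 3 * g2 - y 2 * y 7 * y 8 ^ 2 * g5
  · linear_combination y 4 * y 8 ^ 3 * g0 + y 8 ^ 3 * g4 - y 7 * y 8 ^ 3 * g3
  · linear_combination y 3 * y 7 * y 8 ^ 2 * g3 + y 6 * y 7 ^ 2 * y 8 * g3 - y 7 ^ 2 * y 8 * g2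
  · linear_combination y 3 * y 7 * y 8 * g1 + y 7 ^ 4 * g3 - y 7 ^ 3 * g4 - y 4 * y 7 * y 8 ^ 2 * g5
  · linear_combination y 3 * y 8 ^ 3 * g0 + y 8 ^ 4 * g3
  · linear_combination y 1 * y 7 * y 8 * g2 - y 1 * y 6 * y 8 * g4 + y 4 * y 6 * y 8 * g1 - y 4 * y 7 * y 8 * g4
  · linear_combination y 2 * y 8 ^ 3 * g0 + y 8 ^ 3 * g2
  · linear_combination y 1 * y 8 ^ 3 * g0 + y 8 ^ 3 * g1 - y 7 * y 8 ^ 3 * g5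

/-- The exponent vectors of the monomials `x₁ᵃ x₂ᵇ x₃ᶜ · b` with `b` in the module basis. -/
def normalExponent (n : ℕ × ℕ × ℕ × Fin 8) : Fin 9 →₀ ℕ :=
  Finsupp.single 0 n.1 + Finsupp.single 1 n.2.1 + Finsupp.single 2 n.2.2.1 +
    ![0, Finsupp.single 3 1, Finsupp.single 4 1, Finsupp.single 5 1, Finsupp.single 6 1,
      Finsupp.single 7 1, Finsupp.single 8 1, Finsupp.single 4 1 + Finsupp.single 8 1] n.2.2.2

lemma monomial_normalExponent (n : ℕ × ℕ × ℕ × Fin 8) :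
    (monomial (normalExponent n) 1 : Poly) =
      X 0 ^ n.1 * X 1 ^ n.2.1 * X 2 ^ n.2.2.1 * moduleBasis X n.2.2.2 := by
  obtain ⟨a, b, c, e⟩ := n
  have h (d d' : Fin 9 →₀ ℕ) :
      (monomial (d + d') 1 : Poly) = monomial d 1 * monomial d' 1 := by
    rw [monomial_mul, one_mul]
  simp only [normalExponent, h, X_pow_eq_monomial]
  congr 1
  fin_cases e <;> first | rfl | exact h _ _

lemma map_moduleBasis {R S : Type*} [CommRing R] [CommRing S] (f : R →+* S) (y : Fin 9 → R)
    (e : Fin 8) : f (moduleBasis y e) = moduleBasis (fun i => f (y i)) e := by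
  fin_cases e <;> simp [moduleBasis]

lemma weight_normalExponent_val (n : ℕ × ℕ × ℕ × Fin 8) :
    (weight (normalExponent n) : Fin 3 → ℤ) = ![4 * (n.1 : ℤ), 2 * n.1 + 2 * n.2.1,
      n.1 + n.2.1 + n.2.2.1] + ![![0, 0, 0], ![1, 1, 1], ![0, 1, 1], ![1, 2, 1], ![2, 1, 1],
        ![2, 2, 1], ![3, 2, 1], ![3, 3, 2]] n.2.2.2 := by
  obtain ⟨a, b, c, e⟩ := n
  simp only [normalExponent, map_add, weight_single]
  ext k
  fin_cases e <;> fin_cases k <;> simp [weight_single, hilbertBasis, latticePoint] <;> ring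

lemma weight_normalExponent_injective :
    Function.Injective fun n => weight (normalExponent n) := by
  intro n n' h
  have h' := congrArg Subtype.val h
  simp only [weight_normalExponent_val] at h'
  obtain ⟨a, b, c, e⟩ := n
  obtain ⟨a', b', c', e'⟩ := n'
  have h0 := congrFun h' 0
  have h1 := congrFun h' 1
  have h2 := congrFun h' 2
  clear h h'
  have he : e = e' := by
    revert h0 h1
    fin_cases e <;> fin_cases e' <;> simp <;> omega
  subst he
  simp only [Pi.add_apply, add_left_inj, Matrix.cons_val_zero, Matrix.cons_val_one,
    Matrix.cons_val] at h0 h1 h2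
  simp only [Prod.mk.injEq, and_true]
  omega

lemma mk_lead_eq (j : Fin 20) :
    Ideal.Quotient.mk quadricIdeal (X (quadricLead j).1) *
        Ideal.Quotient.mk quadricIdeal (X (quadricLead j).2) =
      Ideal.Quotient.mk quadricIdeal (X (quadricTail j).1) *
        Ideal.Quotient.mk quadricIdeal (X (quadricTail j).2) := by
  rw [← map_mul, ← map_mul, Ideal.Quotient.eq, ← quadric_eq]
  exact Ideal.subset_span ⟨j, rfl⟩

lemma exists_mk_monomial_mul_eq (d : Fin 9 →₀ ℕ) (n : ℕ × ℕ × ℕ × Fin 8) :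
    ∃ n', Ideal.Quotient.mk quadricIdeal (monomial d 1 * monomial (normalExponent n) 1) =
      Ideal.Quotient.mk quadricIdeal (monomial (normalExponent n') 1) := by
  induction d using Finsupp.induction_linear generalizing n with
  | zero => exact ⟨n, by rw [monomial_zero', C_1, one_mul]⟩
  | add d d' hd hd' =>
    obtain ⟨n₁, h₁⟩ := hd' n
    obtain ⟨n₂, h₂⟩ := hd n₁
    refine ⟨n₂, ?_⟩
    have h : (monomial (d + d') 1 : Poly) = monomial d 1 * monomial d' 1 := by
      rw [monomial_mul, one_mul]
    rw [← h₂, h, mul_assoc, map_mul, h₁, ← map_mul]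
  | single i k =>
    rw [← X_pow_eq_monomial]
    induction k generalizing n with
    | zero => exact ⟨n, by rw [pow_zero, one_mul]⟩
    | succ k ih =>
      obtain ⟨n₁, h₁⟩ := ih n
      obtain ⟨a, b, c, e, h⟩ := exists_mul_moduleBasis
        (fun i => Ideal.Quotient.mk quadricIdeal (X i)) mk_lead_eq i n₁.2.2.2
      refine ⟨(n₁.1 + a, n₁.2.1 + b, n₁.2.2.1 + c, e), ?_⟩
      rw [pow_succ', mul_assoc, map_mul, h₁, monomial_normalExponent, monomial_normalExponent]
      simp only [map_mul, map_pow, map_moduleBasis]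
      rw [mul_left_comm, h]
      ring

lemma exists_mk_monomial_eq (d : Fin 9 →₀ ℕ) :
    ∃ n, Ideal.Quotient.mk quadricIdeal (monomial d 1) =
      Ideal.Quotient.mk quadricIdeal (monomial (normalExponent n) 1) := by
  obtain ⟨n, h⟩ := exists_mk_monomial_mul_eq d (0, 0, 0, 0)
  refine ⟨n, ?_⟩
  rw [← h, monomial_normalExponent]
  simp [moduleBasis]

/-- If two monomials have the same weight, they agree modulo the quadrics. -/
lemma mk_monomial_eq_of_weight_eq {d d' : Fin 9 →₀ ℕ} (h : weight d = weight d') :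
    Ideal.Quotient.mk quadricIdeal (monomial d 1) =
      Ideal.Quotient.mk quadricIdeal (monomial d' 1) := by
  obtain ⟨n, hn⟩ := exists_mk_monomial_eq d
  obtain ⟨n', hn'⟩ := exists_mk_monomial_eq d'
  have key {d : Fin 9 →₀ ℕ} {n} (hn : Ideal.Quotient.mk quadricIdeal (monomial d 1) =
      Ideal.Quotient.mk quadricIdeal (monomial (normalExponent n) 1)) :
      weight d = weight (normalExponent n) := by
    have := quadricIdeal_le_ker (Ideal.Quotient.eq.1 hn)
    rw [RingHom.mem_ker, map_sub, sub_eq_zero, toSemigroupAlgebra_monomial,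
      toSemigroupAlgebra_monomial] at this
    exact AddMonoidAlgebra.single_left_injective one_ne_zero this
  have : n = n' := weight_normalExponent_injective (by
    change weight _ = weight _
    rw [← key hn, ← key hn', h])
  rw [hn, hn', this]

lemma ker_toSemigroupAlgebra : RingHom.ker toSemigroupAlgebra = quadricIdeal := by
  refine le_antisymm (fun f hf => ?_) quadricIdeal_le_ker
  let s : (semigroup cone →₀ ℂ) →ₗ[ℂ] Poly ⧸ quadricIdeal :=
    Finsupp.lsum ℂ fun m => LinearMap.toSpanSingleton ℂ _
      (Ideal.Quotient.mk quadricIdeal (monomial (Function.invFun weight m) 1))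
  have hs (p : Poly) : s (toSemigroupAlgebra p).coeff = Ideal.Quotient.mk quadricIdeal p := by
    induction p using MvPolynomial.induction_on' with
    | monomial d c =>
      have hw : weight (Function.invFun weight (weight d)) = weight d :=
        Function.invFun_eq ⟨d, rfl⟩
      rw [toSemigroupAlgebra_monomial, AddMonoidAlgebra.coeff_single, Finsupp.lsum_single,
        LinearMap.toSpanSingleton_apply, mk_monomial_eq_of_weight_eq hw,
        ← Ideal.Quotient.mkₐ_eq_mk ℂ, ← map_smul, smul_monomial, smul_eq_mul, mul_one]
    | add p q hp hq => rw [map_add, AddMonoidAlgebra.coeff_add, map_add, hp, hq, map_add]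
  rw [← Ideal.Quotient.eq_zero_iff_mem, ← hs, (RingHom.mem_ker).1 hf]
  simp

lemma weight_surjective : Function.Surjective weight := by
  rintro ⟨m, hm⟩
  obtain ⟨h0, h1, h2⟩ := mem_semigroup_cone.1 hm
  suffices h : ∃ n, (weight (normalExponent n) : Fin 3 → ℤ) = m by
    obtain ⟨n, hn⟩ := h
    exact ⟨_, Subtype.ext hn⟩
  have key (e : Fin 8) (p q r : ℤ) (he : ![![0, 0, 0], ![1, 1, 1], ![0, 1, 1], ![1, 2, 1],
      ![2, 1, 1], ![2, 2, 1], ![3, 2, 1], ![3, 3, 2]] e = ![p, q, r])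
      (hp : 4 ∣ m 0 - p) (hq : 4 ∣ 2 * (m 1 - q) - (m 0 - p)) (hr : 2 ∣ 2 * (m 2 - r) - (m 1 - q))
      (hp' : 0 ≤ m 0 - p) (hq' : 0 ≤ 2 * (m 1 - q) - (m 0 - p))
      (hr' : 0 ≤ 2 * (m 2 - r) - (m 1 - q)) :
      ∃ n, (weight (normalExponent n) : Fin 3 → ℤ) = m := by
    refine ⟨(((m 0 - p) / 4).toNat, ((2 * (m 1 - q) - (m 0 - p)) / 4).toNat,
      ((2 * (m 2 - r) - (m 1 - q)) / 2).toNat, e), ?_⟩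
    rw [weight_normalExponent_val, he]
    ext k
    fin_cases k <;> simp <;> omega
  have c0 : m 0 % 4 = 0 ∨ m 0 % 4 = 1 ∨ m 0 % 4 = 2 ∨ m 0 % 4 = 3 := by omega
  have c1 : m 1 % 2 = 0 ∨ m 1 % 2 = 1 := by omega
  rcases c0 with c0 | c0 | c0 | c0 <;> rcases c1 with c1 | c1
  · apply key 0 0 0 0 rfl <;> omega
  · apply key 2 0 1 1 rfl <;> omega
  · apply key 3 1 2 1 rfl <;> omega
  · apply key 1 1 1 1 rfl <;> omega
  · apply key 5 2 2 1 rfl <;> omega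
  · apply key 4 2 1 1 rfl <;> omega
  · apply key 6 3 2 1 rfl <;> omega
  · apply key 7 3 3 2 rfl <;> omega

lemma toSemigroupAlgebra_surjective : Function.Surjective toSemigroupAlgebra := by
  intro f
  induction f using AddMonoidAlgebra.induction_linear with
  | zero => exact ⟨0, map_zero _⟩
  | add f g hf hg =>
    obtain ⟨p, rfl⟩ := hf
    obtain ⟨q, rfl⟩ := hg
    exact ⟨p + q, map_add _ _ _⟩
  | single m c =>
    obtain ⟨d, rfl⟩ := weight_surjective m
    exact ⟨monomial d c, toSemigroupAlgebra_monomial d c⟩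

instance : TwoUniqueSums (semigroup cone) :=
  TwoUniqueSums.of_injective_addHom (semigroup cone).subtype.toAddHom Subtype.val_injective
    inferInstance

instance : IsDomain (SemigroupAlgebra cone) where

lemma variety_eq_zeroLocus : variety = zeroLocus ℂ (RingHom.ker toSemigroupAlgebra) := by
  ext p
  constructor
  · rintro ⟨𝔪, h⟩ f hf
    have hmax := 𝔪.isMaximal
    have hcomp : (Ideal.Quotient.mkₐ ℂ 𝔪.asIdeal).comp toSemigroupAlgebra =
        (Algebra.ofId ℂ (SemigroupAlgebra cone ⧸ 𝔪.asIdeal)).comp (aeval p) := by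
      ext i
      simp only [AlgHom.comp_apply, toSemigroupAlgebra_X, aeval_X, Ideal.Quotient.mkₐ_eq_mk,
        Algebra.ofId_apply]
      exact Ideal.Quotient.eq.2 (h i)
    have := congrArg (fun g => g f) hcomp
    simp only [AlgHom.comp_apply, (RingHom.mem_ker).1 hf, map_zero, Algebra.ofId_apply] at this
    exact (map_eq_zero _).1 this.symm
  · intro hp
    let ev : SemigroupAlgebra cone →ₐ[ℂ] ℂ :=
      (Ideal.Quotient.liftₐ (RingHom.ker toSemigroupAlgebra) (aeval p) hp).comp
        (Ideal.quotientKerAlgEquivOfSurjective toSemigroupAlgebra_surjective).symm.toAlgHom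
    have hev (f : Poly) : ev (toSemigroupAlgebra f) = aeval p f := by
      have : (Ideal.quotientKerAlgEquivOfSurjective toSemigroupAlgebra_surjective).symm
          (toSemigroupAlgebra f) = Ideal.Quotient.mk _ f := by
        rw [AlgEquiv.symm_apply_eq]
        rfl
      simp only [ev, AlgHom.comp_apply]
      erw [this]
      rfl
    refine ⟨⟨RingHom.ker ev, RingHom.ker_isMaximal_of_surjective ev fun c =>
      ⟨algebraMap ℂ _ c, ev.commutes c⟩⟩, fun i => ?_⟩
    rw [RingHom.mem_ker, map_sub, ← toSemigroupAlgebra_X, hev, aeval_X, AlgHom.commutes]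
    exact sub_self _

lemma vanishingIdeal_variety :
    vanishingIdeal ℂ variety = RingHom.ker toSemigroupAlgebra := by
  have : (RingHom.ker toSemigroupAlgebra).IsPrime := RingHom.ker_isPrime _
  rw [variety_eq_zeroLocus, IsPrime.vanishingIdeal_zeroLocus]

lemma exists_coordinateRing_equiv :
    ∃ e : CoordinateRing variety ≃ₐ[ℂ] SemigroupAlgebra cone,
      ∀ i, e (Ideal.Quotient.mk _ (X i)) = character (hilbertBasis i) := by
  exact ⟨(Ideal.quotientEquivAlgOfEq ℂ vanishingIdeal_variety).trans
    (Ideal.quotientKerAlgEquivOfSurjective toSemigroupAlgebra_surjective), toSemigroupAlgebra_X⟩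

lemma I₀_le_ker : I₀ ≤ RingHom.ker toSemigroupAlgebra := by
  have h (s t : Multiset (Fin 9)) (hst : (s.map latticePoint).sum = (t.map latticePoint).sum) :
      toSemigroupAlgebra ((s.map X).prod - (t.map X).prod) = 0 := by
    have key (s : Multiset (Fin 9)) : toSemigroupAlgebra (s.map X).prod =
        AddMonoidAlgebra.single (s.map hilbertBasis).sum 1 := by
      induction s using Multiset.induction with
      | empty => exact map_one toSemigroupAlgebra
      | cons a s ih =>
        rw [Multiset.map_cons, Multiset.prod_cons, map_mul, ih, toSemigroupAlgebra_X, character,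
          AddMonoidAlgebra.single_mul_single, Multiset.map_cons, Multiset.sum_cons, one_mul]
    rw [map_sub, key, key, sub_eq_zero]
    congr 1
    apply Subtype.ext
    have hval (s : Multiset (Fin 9)) : (((s.map hilbertBasis).sum : semigroup cone) : Fin 3 → ℤ) =
        (s.map latticePoint).sum := by
      rw [← AddSubmonoid.subtype_apply, map_multiset_sum, Multiset.map_map]
      rfl
    rw [hval, hval, hst]
  rw [I₀, Ideal.span_le]
  simp only [Set.insert_subset_iff, Set.singleton_subset_iff, SetLike.mem_coe, RingHom.mem_ker]
  refine ⟨?_, ?_, ?_, ?_, ?_, ?_⟩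
  · convert h {0, 7} {8, 8} (by decide) using 3 <;> (simp; try ring)
  · convert h {1, 8, 8} {7, 7, 7} (by decide) using 3 <;> (simp; try ring)
  · convert h {2, 8, 8} {6, 6, 7} (by decide) using 3 <;> (simp; try ring)
  · convert h {3, 8} {6, 7} (by decide) using 3 <;> simp
  · convert h {4, 8, 8} {6, 7, 7} (by decide) using 3 <;> (simp; try ring)
  · convert h {5, 8} {7, 7} (by decide) using 3 <;> (simp; try ring)

lemma quadric_mul_mem_I₀ (j : Fin 20) : quadric j * (x₈ * x₉ ^ 3) ∈ I₀ := by
  have h {a b : Poly} (hab : a - b ∈ ({x₁ * x₈ - x₉ ^ 2, x₂ * x₉ ^ 2 - x₈ ^ 3,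
      x₃ * x₉ ^ 2 - x₇ ^ 2 * x₈, x₄ * x₉ - x₇ * x₈, x₅ * x₉ ^ 2 - x₇ * x₈ ^ 2,
      x₆ * x₉ - x₈ ^ 2} : Set Poly)) : Ideal.Quotient.mk I₀ a = Ideal.Quotient.mk I₀ b :=
    Ideal.Quotient.eq.2 (Ideal.subset_span hab)
  have := lead_sub_tail_mul_eq_zero (fun i => Ideal.Quotient.mk I₀ (X i))
    (by simpa only [map_mul, map_pow] using h (.inl rfl))
    (by simpa only [map_mul, map_pow] using h (.inr (.inl rfl)))
    (by simpa only [map_mul, map_pow] using h (.inr (.inr (.inl rfl))))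
    (by simpa only [map_mul, map_pow] using h (.inr (.inr (.inr (.inl rfl)))))
    (by simpa only [map_mul, map_pow] using h (.inr (.inr (.inr (.inr (.inl rfl))))))
    (by simpa only [map_mul, map_pow] using h (.inr (.inr (.inr (.inr (.inr rfl)))))) j
  rw [← Ideal.Quotient.eq_zero_iff_mem, quadric_eq]
  simpa only [map_mul, map_pow, map_sub] using this

lemma ker_eq_saturation : RingHom.ker toSemigroupAlgebra = saturation I₀ K := by
  apply le_antisymm
  · rw [ker_toSemigroupAlgebra, Ideal.span_le]
    rintro _ ⟨j, rfl⟩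
    refine ⟨3, fun N hN b hb => ?_⟩
    have hb' := Ideal.pow_le_pow_right hN hb
    rw [K, Ideal.span_singleton_pow, Ideal.mem_span_singleton] at hb'
    obtain ⟨c, rfl⟩ := hb'
    have : quadric j * ((x₁ * x₂ * x₃ * x₄ * x₅ * x₆ * x₇ * x₈ * x₉) ^ 3 * c) =
        quadric j * (x₈ * x₉ ^ 3) * ((x₁ * x₂ * x₃ * x₄ * x₅ * x₆ * x₇) ^ 3 * x₈ ^ 2 * c) := by
      ring
    rw [this]
    exact Ideal.mul_mem_right _ _ (quadric_mul_mem_I₀ j)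
  · rintro f ⟨N, hN⟩
    have h := I₀_le_ker (hN N le_rfl _ (Ideal.pow_mem_pow (Ideal.mem_span_singleton_self _) N))
    have hX (i : Fin 9) : toSemigroupAlgebra (X i) ≠ 0 := by
      rw [toSemigroupAlgebra_X, character]
      exact fun h => one_ne_zero (AddMonoidAlgebra.single_eq_zero.1 h)
    rw [RingHom.mem_ker, map_mul, map_pow] at h
    refine (mul_eq_zero.1 h).resolve_right (pow_ne_zero _ ?_)
    simp only [map_mul]
    simp [hX]

/-! The minimal number of generators. -/

lemma quadric_isHomogeneous (j : Fin 20) : (quadric j).IsHomogeneous 2 := by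
  rw [quadric_eq]
  exact ((isHomogeneous_X _ _).mul (isHomogeneous_X _ _)).sub
    ((isHomogeneous_X _ _).mul (isHomogeneous_X _ _))

/-- The exponent vector of `x_a x_b`. -/
def pairExponent (p : Fin 9 × Fin 9) : Fin 9 →₀ ℕ := Finsupp.single p.1 1 + Finsupp.single p.2 1

lemma pairExponent_le_iff {p q : Fin 9 × Fin 9} :
    pairExponent p ≤ pairExponent q ↔ p = q ∨ p = q.swap := by
  constructor
  · intro h
    obtain ⟨r, hr⟩ := exists_add_of_le h
    have hr0 : r = 0 := by
      have := congrArg Finsupp.degree hr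
      exact (Finsupp.degree_eq_zero_iff r).1 (by simpa [pairExponent] using this)
    rw [hr0, add_zero, pairExponent, pairExponent,
      Finsupp.single_add_single_eq_single_add_single one_ne_zero one_ne_zero] at hr
    obtain ⟨a, b⟩ := p
    obtain ⟨c, d⟩ := q
    simp at hr ⊢
    grind
  · rintro (rfl | rfl)
    · rfl
    · rw [pairExponent, pairExponent, add_comm]
      rfl

lemma coeff_mul_pair (g : Poly) (p q : Fin 9 × Fin 9) :
    coeff (pairExponent q) (g * (X p.1 * X p.2)) =
      if p = q ∨ p = q.swap then coeff 0 g else 0 := by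
  have : (X p.1 * X p.2 : Poly) = monomial (pairExponent p) 1 := by
    rw [X, X, monomial_mul, one_mul]
    rfl
  rw [this, coeff_mul_monomial']
  simp only [pairExponent_le_iff, mul_one]
  split_ifs with h
  · have : pairExponent q - pairExponent p = 0 := by
      apply tsub_eq_zero_of_le
      rw [pairExponent_le_iff]
      rcases h with rfl | rfl <;> simp
    rw [this]
  · rfl

/-- The coefficients of the leading monomials of the quadrics. -/
def leadCoeffs : Poly →ₗ[ℂ] (Fin 20 → ℂ) :=
  LinearMap.pi fun j => lcoeff ℂ (pairExponent (quadricLead j))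

lemma leadCoeffs_mul_quadric (g : Poly) (j : Fin 20) :
    leadCoeffs (g * quadric j) = coeff 0 g • Pi.single j 1 := by
  have h1 : ∀ i j : Fin 20,
      (quadricLead j = quadricLead i ∨ quadricLead j = (quadricLead i).swap) ↔ i = j := by
    decide
  have h2 : ∀ i j : Fin 20,
      ¬ (quadricTail j = quadricLead i ∨ quadricTail j = (quadricLead i).swap) := by
    decide
  ext i
  change coeff (pairExponent (quadricLead i)) (g * quadric j) = _
  rw [quadric_eq, mul_sub, coeff_sub, coeff_mul_pair, coeff_mul_pair, if_neg (h2 i j), sub_zero]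
  simp [h1, Pi.single_apply]

lemma leadCoeffs_mul {f : Poly} (hf : f ∈ quadricIdeal) (g : Poly) :
    leadCoeffs (g * f) = coeff 0 g • leadCoeffs f := by
  induction hf using Submodule.span_induction generalizing g with
  | mem x hx =>
    obtain ⟨j, rfl⟩ := hx
    rw [leadCoeffs_mul_quadric, ← one_mul (quadric j), leadCoeffs_mul_quadric]
    simp
  | zero => simp
  | add x y _ _ hx hy => rw [mul_add, map_add, hx, hy, map_add, smul_add]
  | smul a x _ hx =>
    rw [smul_eq_mul, ← mul_assoc, hx, hx a, smul_smul]
    congr 1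
    exact map_mul constantCoeff g a

lemma card_ge_of_span_eq {s : Finset Poly} (hs : Ideal.span (s : Set Poly) = quadricIdeal) :
    20 ≤ s.card := by
  classical
  have key {f : Poly} (hf : f ∈ Ideal.span (s : Set Poly)) :
      leadCoeffs f ∈ Submodule.span ℂ (s.image leadCoeffs : Set (Fin 20 → ℂ)) := by
    induction hf using Submodule.span_induction with
    | mem x hx => exact Submodule.subset_span (by simpa using ⟨x, hx, rfl⟩)
    | zero => simp
    | add x y _ _ hx hy => rw [map_add]; exact add_mem hx hy
    | smul a x h hx =>
      rw [smul_eq_mul, leadCoeffs_mul (hs ▸ h)]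
      exact Submodule.smul_mem _ _ hx
  have htop : Submodule.span ℂ (s.image leadCoeffs : Set (Fin 20 → ℂ)) = ⊤ := by
    rw [eq_top_iff, ← (Pi.basisFun ℂ (Fin 20)).span_eq, Submodule.span_le]
    rintro _ ⟨j, rfl⟩
    have := key (f := quadric j) (hs ▸ Ideal.subset_span ⟨j, rfl⟩)
    rw [← one_mul (quadric j), leadCoeffs_mul_quadric] at this
    simpa using this
  have h := finrank_span_finset_le_card (R := ℂ) (s.image leadCoeffs)
  rw [Set.finrank, htop, finrank_top, Module.finrank_fin_fun] at h
  exact h.trans Finset.card_image_le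

lemma spanFinrank_quadricIdeal : Submodule.spanFinrank quadricIdeal = 20 := by
  apply le_antisymm
  · refine (Submodule.spanFinrank_span_le_ncard_of_finite (Set.finite_range quadric)).trans ?_
    rw [← Set.image_univ]
    exact (Set.ncard_image_le Set.finite_univ).trans (by simp)
  · rw [Submodule.spanFinrank_eq_iInf]
    have : Nonempty {s : Finset Poly // Submodule.span Poly (s : Set Poly) = quadricIdeal} := by
      classical
      exact ⟨⟨Finset.univ.image quadric, by simp [quadricIdeal, Ideal.span]⟩⟩
    exact le_ciInf fun s => card_ge_of_span_eq s.2

lemma span_quadric_compl_ne (j : Fin 20) : Ideal.span (quadric '' {j}ᶜ) ≠ quadricIdeal := by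
  classical
  intro h
  have := card_ge_of_span_eq (s := (Finset.univ.erase j).image quadric) (by
    rw [← h]
    congr 1
    ext
    simp)
  have h' := this.trans Finset.card_image_le
  simp at h'

lemma not_isSchematicCompleteIntersection_of_lt {D : ℕ} {X : Set (Fin D → ℂ)}
    (h : D < Submodule.spanFinrank (vanishingIdeal ℂ X)) :
    ¬ IsSchematicCompleteIntersection X := by
  rintro ⟨d, hd, hX⟩
  rw [hX] at h
  generalize ringKrullDim (CoordinateRing X) = k at hd
  induction k with
  | bot => exact absurd hd (by simp)
  | coe k =>
    have hd' : k + (d : ℕ∞) = D := by exact_mod_cast hd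
    have : (d : ℕ∞) ≤ D := hd' ▸ le_add_self
    exact absurd (Nat.cast_le.1 this) (by omega)

/-! The cone and its dual. -/

lemma mem_dualCone_cone {u : Fin 3 → ℝ} :
    u ∈ dualCone cone ↔ 0 ≤ u 0 ∧ u 0 ≤ 2 * u 1 ∧ u 1 ≤ 2 * u 2 := by
  change u ∈ PointedCone.dual (dotProductBilin ℝ ℝ)
    ((PointedCone.hull ℝ {![1, 0, 0], ![-1, 2, 0], ![0, -1, 2]} :
      PointedCone ℝ (Fin 3 → ℝ)) : Set (Fin 3 → ℝ)) ↔ _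
  rw [PointedCone.dual_hull]
  simp only [PointedCone.mem_dual, Set.mem_insert_iff, Set.mem_singleton_iff, forall_eq_or_imp,
    forall_eq, dotProductBilin_apply_apply, dotProduct, Fin.sum_univ_three]
  simp only [Matrix.cons_val_zero, Matrix.cons_val_one, Matrix.cons_val]
  refine and_congr ?_ (and_congr ?_ ?_) <;> constructor <;> intro h <;> linarith

lemma salient_cone : cone.toConvexCone.Salient := by
  have key {x : Fin 3 → ℝ} (hx : x ∈ cone) :
      0 ≤ 4 * x 0 + 2 * x 1 + x 2 ∧ 0 ≤ 2 * x 1 + x 2 ∧ 0 ≤ x 2 := by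
    induction hx using Submodule.span_induction with
    | mem x hx =>
      rcases hx with rfl | rfl | rfl <;> (simp [Matrix.cons_val]; try norm_num)
    | zero => simp
    | add x y _ _ hx hy =>
      simp only [Pi.add_apply]
      refine ⟨?_, ?_, ?_⟩ <;> linarith
    | smul a x _ hx =>
      obtain ⟨a, ha⟩ := a
      simp only [Pi.smul_apply, Nonneg.mk_smul, smul_eq_mul]
      exact ⟨by nlinarith [mul_nonneg ha hx.1], by nlinarith [mul_nonneg ha hx.2.1],
        mul_nonneg ha hx.2.2⟩
  intro x hx h0 hneg
  obtain ⟨h1, h2, h3⟩ := key hx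
  obtain ⟨h1', h2', h3'⟩ := key hneg
  simp only [Pi.neg_apply] at h1' h2' h3'
  apply h0
  ext k
  fin_cases k <;> simp <;> linarith

lemma mem_hull_singleton {n : ℕ} {v w : Fin n → ℝ} :
    w ∈ PointedCone.hull ℝ {v} ↔ ∃ t : ℝ, 0 ≤ t ∧ w = t • v := by
  rw [PointedCone.hull, Submodule.mem_span_singleton]
  constructor
  · rintro ⟨⟨t, ht⟩, rfl⟩
    exact ⟨t, ht, rfl⟩
  · rintro ⟨t, ht, rfl⟩
    exact ⟨⟨t, ht⟩, rfl⟩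

lemma IsRayGenerator.eq_of_sub_mem {m v : Fin 3 → ℤ} (hm : IsRayGenerator (dualCone cone) m)
    (hv : v ∈ semigroup cone) (hv1 : v 2 = 1) {a : ℝ} (ha : 0 < a)
    (h : toReal m - a • toReal v ∈ dualCone cone) : m = v := by
  obtain ⟨-, hprim, hface⟩ := hm
  have hmem : toReal v ∈ PointedCone.hull ℝ {toReal m} := by
    refine hface.mem_of_smul_add_mem hv h ha ?_
    rw [add_sub_cancel]
    exact mem_hull_singleton.2 ⟨1, zero_le_one, (one_smul _ _).symm⟩
  obtain ⟨t, ht, hvm⟩ := mem_hull_singleton.1 hmem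
  have hi (i : Fin 3) : (v i : ℝ) = t * m i := congrFun hvm i
  have h2 : (1 : ℝ) = t * m 2 := by rw [← hi, hv1, Int.cast_one]
  have hmv : m = m 2 • v := by
    ext i
    have : (m i : ℝ) = m 2 * v i := by
      rw [hi]
      linear_combination (m i : ℝ) * h2
    exact_mod_cast this
  have hpos : 0 < m 2 := by
    by_contra! hle
    have : (m 2 : ℝ) ≤ 0 := by exact_mod_cast hle
    nlinarith
  rcases Int.isUnit_iff.1 (hprim _ _ hmv) with h1 | h1
  · rw [hmv, h1, one_smul]
  · omega

lemma isRayGenerator_of_face {v : Fin 3 → ℤ} (hv : v ∈ semigroup cone) (hv1 : v 2 = 1)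
    (h : ∀ x ∈ dualCone cone, ∀ y ∈ dualCone cone, ∀ a t : ℝ, 0 < a → a • x + y = t • toReal v →
      x = x 2 • toReal v) : IsRayGenerator (dualCone cone) v := by
  refine ⟨?_, fun k m' hk => ?_, ?_, fun {x y a} hx hy ha hxy => ?_⟩
  · rintro rfl
    simp at hv1
  · refine IsUnit.of_mul_eq_one (m' 2) ?_
    rw [← hv1, hk]
    rfl
  · intro x hx
    obtain ⟨t, ht, rfl⟩ := mem_hull_singleton.1 hx
    exact Submodule.smul_mem (dualCone cone) ⟨t, ht⟩ hv
  · obtain ⟨t, -, hxy⟩ := mem_hull_singleton.1 hxy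
    have hx' := mem_dualCone_cone.1 hx
    exact mem_hull_singleton.2 ⟨x 2, by linarith, h x hx y hy a t ha hxy⟩

lemma eq_zero_of_mul_add_eq_zero {a x y : ℝ} (ha : 0 < a) (hx : 0 ≤ x) (hy : 0 ≤ y)
    (h : a * x + y = 0) : x = 0 := by
  have h' := ((add_eq_zero_iff_of_nonneg (mul_nonneg ha.le hx) hy).1 h).1
  exact (mul_eq_zero.1 h').resolve_left ha.ne'

lemma rayGenerators :
    {m | IsRayGenerator (dualCone cone) m} = {![4, 2, 1], ![0, 2, 1], ![0, 0, 1]} := by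
  have t1 : toReal ![4, 2, 1] = ![4, 2, 1] := by ext i; fin_cases i <;> simp [toReal]
  have m1 : ![4, 2, 1] ∈ semigroup cone := latticePoint_mem 0
  have t2 : toReal ![0, 2, 1] = ![0, 2, 1] := by ext i; fin_cases i <;> simp [toReal]
  have m2 : ![0, 2, 1] ∈ semigroup cone := latticePoint_mem 1
  have t3 : toReal ![0, 0, 1] = ![0, 0, 1] := by ext i; fin_cases i <;> simp [toReal]
  have m3 : ![0, 0, 1] ∈ semigroup cone := latticePoint_mem 2
  apply Set.Subset.antisymm
  · intro m hm
    have hm' : toReal m ∈ dualCone cone :=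
      hm.2.2.le (mem_hull_singleton.2 ⟨1, zero_le_one, (one_smul _ _).symm⟩)
    obtain ⟨h0, h1, h2⟩ := mem_dualCone_cone.1 hm'
    rcases h0.lt_or_eq with h0' | h0'
    · refine .inl (hm.eq_of_sub_mem m1 rfl (a := toReal m 0 / 4) (by linarith) ?_)
      rw [mem_dualCone_cone, t1]
      simp only [Pi.sub_apply, Pi.smul_apply, smul_eq_mul, Matrix.cons_val_zero,
        Matrix.cons_val_one, Matrix.cons_val]
      refine ⟨?_, ?_, ?_⟩ <;> linarith
    rcases h1.lt_or_eq with h1' | h1'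
    · refine .inr (.inl (hm.eq_of_sub_mem m2 rfl (a := toReal m 1 / 2) (by linarith) ?_))
      rw [mem_dualCone_cone, t2]
      simp only [Pi.sub_apply, Pi.smul_apply, smul_eq_mul, Matrix.cons_val_zero,
        Matrix.cons_val_one, Matrix.cons_val]
      refine ⟨?_, ?_, ?_⟩ <;> linarith
    rcases h2.lt_or_eq with h2' | h2'
    · refine .inr (.inr (hm.eq_of_sub_mem m3 rfl (a := toReal m 2) (by linarith) ?_))
      rw [mem_dualCone_cone, t3]
      simp only [Pi.sub_apply, Pi.smul_apply, smul_eq_mul, Matrix.cons_val_zero,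
        Matrix.cons_val_one, Matrix.cons_val]
      refine ⟨?_, ?_, ?_⟩ <;> linarith
    · refine absurd ?_ hm.1
      ext i
      have : (m i : ℝ) = 0 := by
        change toReal m i = 0
        fin_cases i <;> simp <;> linarith
      exact_mod_cast this
  · rintro _ (rfl | rfl | rfl)
    · refine isRayGenerator_of_face m1 rfl fun x hx y hy a t ha h => ?_
      obtain ⟨x0, x1, x2⟩ := mem_dualCone_cone.1 hx
      obtain ⟨y0, y1, y2⟩ := mem_dualCone_cone.1 hy
      have e0 : a * x 0 + y 0 = t * 4 := by simpa [toReal] using congrFun h 0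
      have e1 : a * x 1 + y 1 = t * 2 := by simpa [toReal] using congrFun h 1
      have e2 : a * x 2 + y 2 = t := by simpa [toReal] using congrFun h 2
      have f1 := eq_zero_of_mul_add_eq_zero ha (sub_nonneg.2 x1) (sub_nonneg.2 y1)
        (by linear_combination 2 * e1 - e0)
      have f2 := eq_zero_of_mul_add_eq_zero ha (sub_nonneg.2 x2) (sub_nonneg.2 y2)
        (by linear_combination 2 * e2 - e1)
      ext i
      fin_cases i <;> simp [toReal] <;> linarith
    · refine isRayGenerator_of_face m2 rfl fun x hx y hy a t ha h => ?_
      obtain ⟨x0, x1, x2⟩ := mem_dualCone_cone.1 hx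
      obtain ⟨y0, y1, y2⟩ := mem_dualCone_cone.1 hy
      have e0 : a * x 0 + y 0 = 0 := by simpa [toReal] using congrFun h 0
      have e1 : a * x 1 + y 1 = t * 2 := by simpa [toReal] using congrFun h 1
      have e2 : a * x 2 + y 2 = t := by simpa [toReal] using congrFun h 2
      have f0 := eq_zero_of_mul_add_eq_zero ha x0 y0 e0
      have f2 := eq_zero_of_mul_add_eq_zero ha (sub_nonneg.2 x2) (sub_nonneg.2 y2)
        (by linear_combination 2 * e2 - e1)
      ext i
      fin_cases i <;> simp [toReal] <;> linarith
    · refine isRayGenerator_of_face m3 rfl fun x hx y hy a t ha h => ?_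
      obtain ⟨x0, x1, x2⟩ := mem_dualCone_cone.1 hx
      obtain ⟨y0, y1, y2⟩ := mem_dualCone_cone.1 hy
      have e0 : a * x 0 + y 0 = 0 := by simpa [toReal] using congrFun h 0
      have e1 : a * x 1 + y 1 = 0 := by simpa [toReal] using congrFun h 1
      have f0 := eq_zero_of_mul_add_eq_zero ha x0 y0 e0
      have f1 := eq_zero_of_mul_add_eq_zero ha (by linarith) (by linarith) e1
      ext i
      fin_cases i <;> simp [toReal] <;> linarith

/-! The Hilbert basis. -/

lemma latticePoint_injective : Function.Injective latticePoint := by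
  decide

lemma closure_latticePoint :
    AddSubmonoid.closure (Set.range latticePoint) = semigroup cone := by
  apply le_antisymm
  · rw [AddSubmonoid.closure_le]
    rintro _ ⟨i, rfl⟩
    exact latticePoint_mem i
  · intro m hm
    obtain ⟨d, hd⟩ := weight_surjective ⟨m, hm⟩
    have hd' : (weight d : Fin 3 → ℤ) = m := congrArg Subtype.val hd
    rw [← hd']
    clear hd hd'
    induction d using Finsupp.induction_linear with
    | zero => simp
    | add f g hf hg => rw [map_add]; exact add_mem hf hg
    | single i k =>
      rw [weight_single]
      exact nsmul_mem (AddSubmonoid.subset_closure (Set.mem_range_self i)) k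

lemma mem_of_mem_closure_of_height_eq_one {H : Set (Fin 3 → ℤ)} (hH : ∀ h ∈ H, h 2 = 1)
    {m : Fin 3 → ℤ} (hm : m ∈ AddSubmonoid.closure H) (h1 : m 2 = 1) : m ∈ H := by
  have key : m = 0 ∨ m ∈ H ∨ 2 ≤ m 2 := by
    clear h1
    induction hm using AddSubmonoid.closure_induction with
    | mem x hx => exact .inr (.inl hx)
    | zero => exact .inl rfl
    | add x y _ _ hx hy =>
      rcases hx with rfl | hx | hx
      · simpa using hy
      · rcases hy with rfl | hy | hy
        · exact .inr (.inl (by simpa using hx))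
        · refine .inr (.inr ?_)
          rw [Pi.add_apply, hH x hx, hH y hy]
          norm_num
        · refine .inr (.inr ?_)
          rw [Pi.add_apply, hH x hx]
          omega
      · refine .inr (.inr ?_)
        rcases hy with rfl | hy | hy
        · simpa using hx
        · rw [Pi.add_apply, hH y hy]
          omega
        · rw [Pi.add_apply]
          omega
  rcases key with rfl | h | h
  · simp at h1
  · exact h
  · omega

lemma isHilbertBasis_latticePoint : IsHilbertBasis cone (Set.range latticePoint) := by
  have height (i : Fin 9) : latticePoint i 2 = 1 := by revert i; decide
  refine ⟨closure_latticePoint, fun H' hH' h => hH'.2 ?_, ?_⟩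
  · rintro _ ⟨i, rfl⟩
    refine mem_of_mem_closure_of_height_eq_one (fun x hx => ?_) (h ▸ latticePoint_mem i) (height i)
    obtain ⟨j, rfl⟩ := hH'.1 hx
    exact height j
  · rw [rayGenerators]
    rintro _ (rfl | rfl | rfl)
    · exact ⟨0, rfl⟩
    · exact ⟨1, rfl⟩
    · exact ⟨2, rfl⟩

/-! The quotient by `ℤ₄`. -/

lemma generator_pow_coe (k : ℕ) :
    (generator ^ k).1 = Matrix.diagonal ![Complex.I ^ k, Complex.I ^ k, (-1) ^ k] := by
  rw [Matrix.SpecialLinearGroup.coe_pow, generator, Matrix.diagonal_pow]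
  congr 1
  ext i
  fin_cases i <;> rfl

lemma orderOf_generator : orderOf generator = 4 := by
  refine orderOf_eq_prime_pow (p := 2) (n := 1) ?_ ?_
  · intro h
    have := congrArg (fun g => g.1 0 0) h
    rw [generator_pow_coe] at this
    norm_num at this
  · apply Subtype.ext
    rw [generator_pow_coe]
    have : (![Complex.I ^ 2 ^ (1 + 1), Complex.I ^ 2 ^ (1 + 1), (-1) ^ 2 ^ (1 + 1)] :
        Fin 3 → ℂ) = 1 := by
      ext i
      fin_cases i <;> norm_num
    rw [this]
    exact Matrix.diagonal_one

lemma card_Z4 : Nat.card Z4 = 4 := by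
  rw [Z4, Nat.card_zpowers, orderOf_generator]

/-- The character of `ℤ₄` acting on the monomial with exponent vector `d`. -/
lemma substitution_generator_pow_monomial (k : ℕ) (d : Fin 3 →₀ ℕ) (c : ℂ) :
    substitution (generator ^ k) (monomial d c) =
      monomial d (c * Complex.I ^ (k * (d 0 + d 1 + 2 * d 2))) := by
  have hX (i : Fin 3) : substitution (generator ^ k) (X i) =
      C (![Complex.I ^ k, Complex.I ^ k, (-1) ^ k] i) * X i := by
    rw [substitution, aeval_X, generator_pow_coe, Finset.sum_eq_single i]
    · rw [Matrix.diagonal_apply_eq]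
    · intro j _ hj
      rw [Matrix.diagonal_apply_ne' _ hj, C_0, zero_mul]
    · simp
  have hI : (-1 : ℂ) = Complex.I ^ 2 := by simp
  have hm (a : ℂ) : monomial d a = C a * (X 0 ^ d 0 * X 1 ^ d 1 * X 2 ^ d 2) := by
    rw [monomial_eq, Finsupp.prod_fintype _ _ (by simp), Fin.prod_univ_three]
  rw [hm, hm]
  simp only [map_mul, map_pow, hX, algHom_C]
  simp only [Matrix.cons_val_zero, Matrix.cons_val_one, Matrix.cons_val, hI, map_pow, mul_pow,
    algebraMap_eq]
  ring

lemma mem_invariantRing_Z4 {f : MvPolynomial (Fin 3) ℂ} :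
    f ∈ invariantRing Z4 ↔ ∀ d ∈ f.support, 4 ∣ d 0 + d 1 + 2 * d 2 := by
  have hsub (k : ℕ) (d : Fin 3 →₀ ℕ) : coeff d (substitution (generator ^ k) f) =
      coeff d f * Complex.I ^ (k * (d 0 + d 1 + 2 * d 2)) := by
    induction f using MvPolynomial.induction_on' with
    | monomial u a =>
      rw [substitution_generator_pow_monomial, coeff_monomial, coeff_monomial]
      split_ifs with h
      · rw [h]
      · rw [zero_mul]
    | add p q hp hq => rw [map_add, coeff_add, hp, hq, coeff_add, add_mul]
  have hdvd (m : ℕ) : Complex.I ^ m = 1 ↔ 4 ∣ m :=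
    Complex.isPrimitiveRoot_I.pow_eq_one_iff_dvd m
  have hmem : f ∈ invariantRing Z4 ↔ ∀ g ∈ Z4, substitution g f = f := by
    simp only [invariantRing, Algebra.mem_iInf, AlgHom.mem_equalizer, AlgHom.id_apply]
  rw [hmem]
  constructor
  · intro h d hd
    have := hsub 1 d
    rw [pow_one, h _ (Subgroup.mem_zpowers _), one_mul, eq_comm] at this
    rw [← hdvd]
    exact mul_left_cancel₀ (mem_support_iff.1 hd) (this.trans (mul_one _).symm)
  · intro h g hg
    have hfin : IsOfFinOrder generator := by
      rw [← orderOf_pos_iff, orderOf_generator]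
      norm_num
    obtain ⟨k, rfl⟩ := (hfin.mem_powers_iff_mem_zpowers.2 hg)
    ext d
    change coeff d (substitution (generator ^ k) f) = _
    rw [hsub]
    by_cases hd : d ∈ f.support
    · rw [(hdvd _).2 ((h d hd).mul_left k), mul_one]
    · rw [notMem_support_iff.1 hd, zero_mul]

/-- The exponent vector of the invariant monomial corresponding to a point of `S_σ`: its pairings
with the generators of `σ`. -/
def invariantExponent : semigroup cone →+ (Fin 3 →₀ ℕ) where
  toFun m := Finsupp.equivFunOnFinite.symm
    ![(m.1 0).toNat, (2 * m.1 1 - m.1 0).toNat, (2 * m.1 2 - m.1 1).toNat]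
  map_zero' := by
    ext i
    fin_cases i <;> simp
  map_add' m m' := by
    have h := mem_semigroup_cone.1 m.2
    have h' := mem_semigroup_cone.1 m'.2
    ext i
    fin_cases i <;> simp <;> omega

lemma invariantExponent_injective : Function.Injective invariantExponent := by
  intro m m' h
  have hm := mem_semigroup_cone.1 m.2
  have hm' := mem_semigroup_cone.1 m'.2
  have h0 : (m.1 0).toNat = (m'.1 0).toNat := DFunLike.congr_fun h 0
  have h1 : (2 * m.1 1 - m.1 0).toNat = (2 * m'.1 1 - m'.1 0).toNat := DFunLike.congr_fun h 1
  have h2 : (2 * m.1 2 - m.1 1).toNat = (2 * m'.1 2 - m'.1 1).toNat := DFunLike.congr_fun h 2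
  apply Subtype.ext
  ext i
  fin_cases i
  · change m.1 0 = m'.1 0
    omega
  · change m.1 1 = m'.1 1
    omega
  · change m.1 2 = m'.1 2
    omega

lemma mem_range_invariantExponent {d : Fin 3 →₀ ℕ} :
    d ∈ Set.range invariantExponent ↔ 4 ∣ d 0 + d 1 + 2 * d 2 := by
  constructor
  · rintro ⟨m, rfl⟩
    have h := mem_semigroup_cone.1 m.2
    change 4 ∣ (m.1 0).toNat + (2 * m.1 1 - m.1 0).toNat + 2 * (2 * m.1 2 - m.1 1).toNat
    omega
  · rintro ⟨r, hr⟩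
    refine ⟨⟨![d 0, 2 * r - d 2, r], mem_semigroup_cone.2 ?_⟩, ?_⟩
    · simp only [Matrix.cons_val_zero, Matrix.cons_val_one, Matrix.cons_val]
      omega
    · ext i
      fin_cases i
      · change ((d 0 : ℤ)).toNat = d 0
        omega
      · change (2 * (2 * (r : ℤ) - d 2) - d 0).toNat = d 1
        omega
      · change (2 * (r : ℤ) - (2 * r - d 2)).toNat = d 2
        omega

/-- The embedding `ℂ[S_σ] → ℂ[z₁, z₂, z₃]`. -/
def toInvariants : SemigroupAlgebra cone →ₐ[ℂ] MvPolynomial (Fin 3) ℂ :=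
  AddMonoidAlgebra.mapDomainAlgHom ℂ ℂ invariantExponent

lemma toInvariants_single (m : semigroup cone) (c : ℂ) :
    toInvariants (AddMonoidAlgebra.single m c) = monomial (invariantExponent m) c :=
  AddMonoidAlgebra.mapDomain_single

lemma range_toInvariants : toInvariants.range = invariantRing Z4 := by
  apply le_antisymm
  · rintro _ ⟨f, rfl⟩
    change toInvariants f ∈ _
    induction f using AddMonoidAlgebra.induction_linear with
    | zero => rw [map_zero]; exact zero_mem _
    | add f g hf hg => rw [map_add]; exact add_mem hf hg
    | single m c =>
      rw [toInvariants_single, mem_invariantRing_Z4]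
      intro d hd
      rw [Finset.mem_singleton.1 (support_monomial_subset hd)]
      exact mem_range_invariantExponent.1 ⟨m, rfl⟩
  · intro f hf
    rw [f.as_sum]
    refine sum_mem fun d hd => ?_
    obtain ⟨m, rfl⟩ := mem_range_invariantExponent.2 (mem_invariantRing_Z4.1 hf d hd)
    exact ⟨AddMonoidAlgebra.single m _, toInvariants_single _ _⟩

lemma nonempty_invariantRing_equiv :
    Nonempty (invariantRing Z4 ≃ₐ[ℂ] SemigroupAlgebra cone) := by
  have hinj : Function.Injective toInvariants :=
    AddMonoidAlgebra.mapDomain_injective invariantExponent_injective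
  exact ⟨((AlgEquiv.ofInjective toInvariants hinj).trans
    (Subalgebra.equivOfEq _ _ range_toInvariants)).symm⟩

end

end ToricC3Z4

theorem mainTheorem5 :
    -- `σ` is strongly convex, and its dual cone has the three stated rational generators
    ToricC3Z4.cone.toConvexCone.Salient ∧
    {m | ToricC3Z4.IsRayGenerator (ToricC3Z4.dualCone ToricC3Z4.cone) m} =
      {![4, 2, 1], ![0, 2, 1], ![0, 0, 1]} ∧
    -- the nine (distinct) lattice points form a Hilbert basis of `S_σ`
    Function.Injective ToricC3Z4.latticePoint ∧
    ToricC3Z4.IsHilbertBasis ToricC3Z4.cone (Set.range ToricC3Z4.latticePoint) ∧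
    -- `X_σ` is `ℂ³ / ℤ₄`
    Nat.card ToricC3Z4.Z4 = 4 ∧
    Nonempty (ToricC3Z4.invariantRing ToricC3Z4.Z4 ≃ₐ[ℂ]
      ToricC3Z4.SemigroupAlgebra ToricC3Z4.cone) ∧
    -- `X ⊆ ℂ⁹` is Zariski closed, with coordinate ring `ℂ[S_σ]`, where `x_i` is `χ^(m_i)`
    MvPolynomial.zeroLocus ℂ (MvPolynomial.vanishingIdeal ℂ ToricC3Z4.variety) =
      ToricC3Z4.variety ∧
    (∃ e : ToricC3Z4.CoordinateRing ToricC3Z4.variety ≃ₐ[ℂ]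
        ToricC3Z4.SemigroupAlgebra ToricC3Z4.cone,
      ∀ i, e (Ideal.Quotient.mk _ (MvPolynomial.X i)) =
        ToricC3Z4.character (ToricC3Z4.hilbertBasis i)) ∧
    -- the ideal of `X` is the saturation of the ideal of the six binomials
    MvPolynomial.vanishingIdeal ℂ ToricC3Z4.variety =
      ToricC3Z4.saturation ToricC3Z4.I₀ ToricC3Z4.K ∧
    -- it is minimally generated by the 20 quadrics, and not by fewer than 20 elements
    (∀ j, (ToricC3Z4.quadric j).IsHomogeneous 2) ∧
    Ideal.span (Set.range ToricC3Z4.quadric) =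
      MvPolynomial.vanishingIdeal ℂ ToricC3Z4.variety ∧
    (∀ j, Ideal.span (ToricC3Z4.quadric '' {j}ᶜ) ≠
      MvPolynomial.vanishingIdeal ℂ ToricC3Z4.variety) ∧
    Submodule.spanFinrank (MvPolynomial.vanishingIdeal ℂ ToricC3Z4.variety) = 20 ∧
    -- hence `X` is not a schematic complete intersection
    ¬ ToricC3Z4.IsSchematicCompleteIntersection ToricC3Z4.variety := by
  have hI : MvPolynomial.vanishingIdeal ℂ ToricC3Z4.variety = ToricC3Z4.quadricIdeal := by
    rw [ToricC3Z4.vanishingIdeal_variety, ToricC3Z4.ker_toSemigroupAlgebra]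
  have hrank : Submodule.spanFinrank (MvPolynomial.vanishingIdeal ℂ ToricC3Z4.variety) = 20 := by
    rw [hI, ToricC3Z4.spanFinrank_quadricIdeal]
  exact ⟨ToricC3Z4.salient_cone, ToricC3Z4.rayGenerators, ToricC3Z4.latticePoint_injective,
    ToricC3Z4.isHilbertBasis_latticePoint,
    ToricC3Z4.card_Z4, ToricC3Z4.nonempty_invariantRing_equiv,
    by rw [ToricC3Z4.vanishingIdeal_variety, ← ToricC3Z4.variety_eq_zeroLocus],
    ToricC3Z4.exists_coordinateRing_equiv,
    by rw [ToricC3Z4.vanishingIdeal_variety, ToricC3Z4.ker_eq_saturation],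
    ToricC3Z4.quadric_isHomogeneous, hI.symm,
    fun j => hI ▸ ToricC3Z4.span_quadric_compl_ne j, hrank,
    ToricC3Z4.not_isSchematicCompleteIntersection_of_lt (hrank ▸ by norm_num)⟩
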